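/- Let $A\in\mathrm{GL}_2(\mathbb Z)$ and let $G_A=\mathbb Z^2\rtimes_A\mathbb Z$ be the semidirect product in which the generator $1\in\mathbb Z$ acts on $\mathbb Z^2$ by $v\mapsto Av$. Let $g\in\mathbb Z^2\le G_A$ and assume that - either $|\mathrm{tr}(A)|>2$ (and $g$ is arbitrary), - or $|\mathrm{tr}(A)|=2$, $A\ne I_2$, $A\ne -I_2$, and $g$ is an eigenvector of $A$. (i) Suppose that $G_A$ acts by Lipschitz homeomorphisms on a non-empty compact finite-dimensional manifold $M$ (possibly with boundary or corners) whose topology is given by a metric $d$ for which every point has a neighbourhood on which some chart is bi-Lipschitz (for instance, the Riemannian distance of a connected Riemannian manifold); that is, for every $h\in G_A$ there is $K$ with $d(hx,hy)\le K\,d(x,y)$ for all $x,y\in M$. Then the topological entropy of $g$ is zero: $h_{top}(g)=0$. (ii) Suppose that $G_A$ acts by $C^2$-diffeomorphisms on a compact Hausdorff finite-dimensional $C^2$ manifold $M$ (possibly with boundary or corners), and let $\|\cdot\|$ be the norm of a continuous Riemannian metric on $M$. Then all Lyapunov exponents of $g$ are zero: for every $x\in M$ and every non-zero $u\in T_xM$,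 the limit $$\chi(x,u,g)=\lim_{n\to+\infty}\frac1n\log\|D_xg^n(u)\|$$ exists and equals $0$. -/

import Mathlib

open Filter Topology Manifold Bundle
open scoped Matrix ContDiff MatrixGroups

/-- The automorphism `v ↦ A v` of the (multiplicatively written) group `ℤ²`. -/
def matrixAut (A : GL (Fin 2) ℤ) : MulAut (Multiplicative (Fin 2 → ℤ)) where
  toFun v := Multiplicative.ofAdd ((A : Matrix (Fin 2) (Fin 2) ℤ) *ᵥ v.toAdd)
  invFun v := Multiplicative.ofAdd (((A⁻¹ : GL (Fin 2) ℤ) : Matrix (Fin 2) (Fin 2) ℤ) *ᵥ v.toAdd)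
  left_inv v := by simp only [toAdd_ofAdd, Matrix.mulVec_mulVec, Units.inv_mul,
    Matrix.one_mulVec, ofAdd_toAdd]
  right_inv v := by simp only [toAdd_ofAdd, Matrix.mulVec_mulVec, Units.mul_inv,
    Matrix.one_mulVec, ofAdd_toAdd]
  map_mul' v w := by simp only [toAdd_mul, Matrix.mulVec_add, ofAdd_add]

/-- The semidirect product `ℤ² ⋊_A ℤ`, in which `k ∈ ℤ` acts on `ℤ²` by `v ↦ A ^ k v`. -/
abbrev SemidirectGroup (A : GL (Fin 2) ℤ) : Type :=
  Multiplicative (Fin 2 → ℤ) ⋊[zpowersHom (MulAut (Multiplicative (Fin 2 → ℤ))) (matrixAut A)]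
    Multiplicative ℤ

/-- The element of `ℤ² ⋊_A ℤ` given by `v ∈ ℤ²`. -/
def latticeElt (A : GL (Fin 2) ℤ) (v : Fin 2 → ℤ) : SemidirectGroup A :=
  SemidirectProduct.inl (Multiplicative.ofAdd v)

/-- The distance of `M` belongs to its manifold structure: near every point, a chart of `M` is
bi-Lipschitz. The Riemannian distance of a connected Riemannian manifold has this property. -/
def HasBiLipschitzCharts {E : Type*} [NormedAddCommGroup E] [NormedSpace ℝ E]
    {H : Type*} [TopologicalSpace H] (I : ModelWithCorners ℝ E H)
    (M : Type*) [MetricSpace M] [ChartedSpace H M] : Prop :=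
  ∀ x : M, ∃ U ∈ 𝓝 x, U ⊆ (extChartAt I x).source ∧ ∃ K : ℝ, ∀ y ∈ U, ∀ z ∈ U,
    dist (extChartAt I x y) (extChartAt I x z) ≤ K * dist y z ∧
      dist y z ≤ K * dist (extChartAt I x y) (extChartAt I x z)

/-- The topological entropy of a self-map of a compact metric space. -/
noncomputable def topEntropy {X : Type*} [UniformSpace X] (f : X → X) : EReal :=
  Dynamics.coverEntropy f Set.univ

/-- The Lyapunov exponent of `f` at the point `x` in the direction of the tangent vector `u` exists
and is equal to `χ`, that is, `χ = lim (1 / n) log ‖D_x fⁿ (u)‖`. -/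
def HasLyapunovExponent {E : Type*} [NormedAddCommGroup E] [NormedSpace ℝ E]
    {H : Type*} [TopologicalSpace H] (I : ModelWithCorners ℝ E H)
    {M : Type*} [TopologicalSpace M] [ChartedSpace H M]
    [RiemannianBundle (fun x : M => TangentSpace I x)]
    (f : M → M) (x : M) (u : TangentSpace I x) (χ : ℝ) : Prop :=
  Tendsto (fun n : ℕ => Real.log ‖mfderiv I I f^[n] x u‖ / n) atTop (𝓝 χ)

/-!
The element `g = latticeElt A v` is distorted in `ℤ² ⋊_A ℤ`: its powers `gⁿ` have sublinear length
for every length function. A Lipschitz constant, or a bound for the norm of the derivative, is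
submultiplicative under composition, so its logarithm is such a length function, and the constants
of `gⁿ` and of `g⁻ⁿ` are `exp (o(n))`.

Distortion is obtained without computing word lengths (`stableLength_latticeElt_eq_zero`). For a
subadditive `ℓ ≥ 0` on the group, Fekete's lemma gives the stable length `τ g = lim ℓ (gⁿ) / n`,
which is invariant under conjugation, homogeneous for powers, and subadditive on commuting elements.
Hence `T v = τ v + τ (-v)` is a seminorm on `ℤ²` with `T (A v) = T v`. In the hyperbolic case the
Cayley–Hamilton identity `tr A • v = A v + adj A v` gives `|tr A| T v ≤ 2 T v`, so `T = 0`. In the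
parabolic case there is `w` with `A w = μ w + k v`, `μ = ±1`, `k ≠ 0`; then `Aⁿ w = ±(w + n μ k v)`
has the same `T` as `w`, so that `n |k| T v` stays bounded and `T v = 0`
(`invariant_seminorm_eq_zero`).

For entropy, a compact manifold with bi-Lipschitz charts of dimension `m` is covered by `O(δ⁻ᵐ)`
balls of radius `δ`; with `δ = ε exp (-ηn - C)` these balls lie in dynamical balls of order `n`, so
the entropy is at most `m η` for every `η > 0` (`topEntropy_eq_zero`). For Lyapunov exponents, the
derivative of each element is bounded by compactness (`exists_norm_mfderiv_le_exp`), and the bounds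
on `D gⁿ` and `D g⁻ⁿ` squeeze `log ‖D gⁿ u‖ / n` to `0` (`hasLyapunovExponent_zero`).
-/

/-! ### Stable length on a group -/

section StableLength

variable {G : Type*} [Group G]

/-- The stable length `lim ℓ (g ^ n) / n` of `g` with respect to a length function `ℓ`. It is
encoded as an infimum, which agrees with the limit for subadditive `ℓ ≥ 0` by Fekete's lemma. -/
noncomputable def stableLength (ℓ : G → ℝ) (g : G) : ℝ :=
  sInf ((fun n : ℕ => ℓ (g ^ n) / n) '' Set.Ici 1)

variable {ℓ : G → ℝ} (hnn : ∀ g, 0 ≤ ℓ g) (hmul : ∀ g h, ℓ (g * h) ≤ ℓ g + ℓ h)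
include hnn

theorem stableLength_nonneg (g : G) : 0 ≤ stableLength ℓ g := by
  apply Real.sInf_nonneg
  rintro _ ⟨n, -, rfl⟩
  have := hnn (g ^ n)
  positivity

include hmul

theorem tendsto_stableLength (g : G) :
    Tendsto (fun n : ℕ => ℓ (g ^ n) / n) atTop (𝓝 (stableLength ℓ g)) := by
  have hsub : Subadditive fun n : ℕ => ℓ (g ^ n) := fun m n => by
    simpa only [pow_add] using hmul (g ^ m) (g ^ n)
  have hlim : hsub.lim = stableLength ℓ g := by rw [Subadditive.lim, stableLength]
  refine hlim ▸ hsub.tendsto_lim ⟨0, ?_⟩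
  rintro _ ⟨n, rfl⟩
  have := hnn (g ^ n)
  positivity

theorem stableLength_pow (g : G) (k : ℕ) :
    stableLength ℓ (g ^ k) = k * stableLength ℓ g := by
  refine tendsto_nhds_unique (tendsto_stableLength hnn hmul (g ^ k)) ?_
  rcases Nat.eq_zero_or_pos k with rfl | hk
  · simpa using tendsto_const_div_atTop_nhds_zero_nat (ℓ 1)
  · have h := ((tendsto_stableLength hnn hmul g).comp
      (tendsto_id.const_mul_atTop' hk)).const_mul (k : ℝ)
    refine h.congr fun n => ?_
    have hk' : (k : ℝ) ≠ 0 := by positivity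
    simp only [Function.comp_apply, id_eq, Nat.cast_mul, pow_mul]
    field_simp

theorem stableLength_mul_le {g h : G} (hgh : Commute g h) :
    stableLength ℓ (g * h) ≤ stableLength ℓ g + stableLength ℓ h := by
  refine le_of_tendsto_of_tendsto' (tendsto_stableLength hnn hmul (g * h))
    ((tendsto_stableLength hnn hmul g).add (tendsto_stableLength hnn hmul h)) fun n => ?_
  rw [hgh.mul_pow, ← add_div]
  gcongr
  exact hmul _ _

theorem stableLength_conj_le (g h : G) :
    stableLength ℓ (h * g * h⁻¹) ≤ stableLength ℓ g := by
  have hlim := (tendsto_stableLength hnn hmul g).add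
    (tendsto_const_div_atTop_nhds_zero_nat (ℓ h + ℓ h⁻¹))
  rw [add_zero] at hlim
  refine le_of_tendsto_of_tendsto' (tendsto_stableLength hnn hmul (h * g * h⁻¹)) hlim fun n => ?_
  rw [conj_pow, ← add_div]
  gcongr
  linarith [hmul (h * g ^ n) h⁻¹, hmul h (g ^ n)]

theorem stableLength_conj (g h : G) : stableLength ℓ (h * g * h⁻¹) = stableLength ℓ g := by
  refine (stableLength_conj_le hnn hmul g h).antisymm ?_
  simpa [mul_assoc] using stableLength_conj_le hnn hmul (h * g * h⁻¹) h⁻¹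

end StableLength

/-! ### Seminorms on `ℤ²` invariant under an integral matrix -/

section InvariantSeminorm

variable {A : GL (Fin 2) ℤ} {T : (Fin 2 → ℤ) → ℝ}

theorem det_eq_one_or_neg_one (A : GL (Fin 2) ℤ) :
    (A : Matrix (Fin 2) (Fin 2) ℤ).det = 1 ∨ (A : Matrix (Fin 2) (Fin 2) ℤ).det = -1 :=
  Int.isUnit_iff.1 ((Matrix.isUnit_iff_isUnit_det (A : Matrix (Fin 2) (Fin 2) ℤ)).1 A.isUnit)

theorem invariant_seminorm_eq_zero_of_two_lt_abs_trace
    (hnn : ∀ v, 0 ≤ T v) (hadd : ∀ v w, T (v + w) ≤ T v + T w)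
    (hsmul : ∀ (k : ℤ) v, T (k • v) = |k| * T v)
    (hA : ∀ v, T ((A : Matrix (Fin 2) (Fin 2) ℤ) *ᵥ v) = T v)
    (htr : 2 < |(A : Matrix (Fin 2) (Fin 2) ℤ).trace|) (v : Fin 2 → ℤ) : T v = 0 := by
  set B : Matrix (Fin 2) (Fin 2) ℤ := A.val
  have hadj : T (B.adjugate *ᵥ v) = T v := by
    rw [← hA, Matrix.mulVec_mulVec, Matrix.mul_adjugate, Matrix.smul_mulVec, Matrix.one_mulVec,
      hsmul]
    rcases det_eq_one_or_neg_one A with h | h <;> simp [B, h]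
  have hch : B.trace • v = B *ᵥ v + B.adjugate *ᵥ v := by
    ext i
    fin_cases i <;>
      simp [dotProduct, Fin.sum_univ_two, Matrix.trace_fin_two,
        Matrix.adjugate_fin_two] <;> ring
  have h := hadd (B *ᵥ v) (B.adjugate *ᵥ v)
  rw [← hch, hsmul, hadj, hA] at h
  have htr' : (3 : ℝ) ≤ (|B.trace| : ℤ) := by exact_mod_cast htr
  nlinarith [hnn v]

/-- A matrix of determinant `±1` and trace `±2` with an integral eigenvector, other than `±1`, is a
nontrivial Jordan block up to finite index. -/
theorem exists_mulVec_eq_smul_add_smul {B : Matrix (Fin 2) (Fin 2) ℤ}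
    (hdet : B.det = 1 ∨ B.det = -1) (htr : |B.trace| = 2) (h1 : B ≠ 1) (h2 : B ≠ -1)
    {μ : ℤ} {v : Fin 2 → ℤ} (hv : v ≠ 0) (hμ : B *ᵥ v = μ • v) :
    |μ| = 1 ∧ ∃ (w : Fin 2 → ℤ) (k : ℤ), k ≠ 0 ∧ B *ᵥ w = μ • w + k • v := by
  obtain ⟨a, b, c, d, rfl⟩ : ∃ a b c d, B = !![a, b; c, d] := ⟨_, _, _, _, B.eta_fin_two⟩
  obtain ⟨x, y, rfl⟩ : ∃ x y, v = ![x, y] := ⟨v 0, v 1, by ext i; fin_cases i <;> rfl⟩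
  have e1 : a * x + b * y = μ * x := by simpa [mul_comm] using congrFun hμ 0
  have e2 : c * x + d * y = μ * y := by simpa [mul_comm] using congrFun hμ 1
  rw [Matrix.det_fin_two_of] at hdet
  rw [Matrix.trace_fin_two_of] at htr
  have hchar : μ * (a + d - μ) = a * d - b * c := by
    have hx : (μ * (a + d - μ) - (a * d - b * c)) * x = 0 := by
      linear_combination (μ - d) * e1 + b * e2
    have hy : (μ * (a + d - μ) - (a * d - b * c)) * y = 0 := by
      linear_combination (μ - a) * e2 + c * e1
    have hxy : x ≠ 0 ∨ y ≠ 0 := by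
      by_contra! h
      exact hv (by simp [h.1, h.2])
    rcases hxy with h | h
    · linarith [(mul_eq_zero.1 hx).resolve_right h]
    · linarith [(mul_eq_zero.1 hy).resolve_right h]
  have hunit : IsUnit (μ * (a + d - μ)) := by rw [hchar, Int.isUnit_iff]; exact hdet
  have hμ1 := Int.isUnit_iff.1 (isUnit_of_mul_isUnit_left hunit)
  have hμ2 := Int.isUnit_iff.1 (isUnit_of_mul_isUnit_right hunit)
  have hd : d = 2 * μ - a := by
    rcases abs_eq (by norm_num : (0 : ℤ) ≤ 2) |>.1 htr with h | h <;> omega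
  subst hd
  have hne : a - μ ≠ 0 ∨ c ≠ 0 ∨ b ≠ 0 := by
    by_contra! h
    obtain ⟨h, rfl, rfl⟩ := h
    obtain rfl : a = μ := by linarith
    rcases hμ1 with rfl | rfl
    · exact h1 (by ext i j; fin_cases i <;> fin_cases j <;> rfl)
    · exact h2 (by ext i j; fin_cases i <;> fin_cases j <;> rfl)
  refine ⟨by rcases hμ1 with rfl | rfl <;> rfl, ?_⟩
  -- `B - μ` has rank one and image in the line of `v`; a nonzero entry of it serves as `k`.
  by_cases hp : a - μ = 0
  · by_cases hc : c = 0
    · refine ⟨![0, x], b, by tauto, ?_⟩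
      ext i
      fin_cases i
      · simp [mul_comm]
      · subst hc
        simp
        obtain rfl : a = μ := by linarith
        linear_combination - e1
    · refine ⟨![y, 0], c, hc, ?_⟩
      ext i
      fin_cases i
      · simp
        linear_combination -e2
      · simp [mul_comm]
  · refine ⟨![x, 0], a - μ, hp, ?_⟩
    ext i
    fin_cases i
    · simp; ring
    · simp
      linear_combination e2

theorem invariant_seminorm_eq_zero_of_parabolic
    (hnn : ∀ v, 0 ≤ T v) (hadd : ∀ v w, T (v + w) ≤ T v + T w)
    (hsmul : ∀ (k : ℤ) v, T (k • v) = |k| * T v)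
    (hA : ∀ v, T ((A : Matrix (Fin 2) (Fin 2) ℤ) *ᵥ v) = T v)
    {μ k : ℤ} (hμ : |μ| = 1) (hk : k ≠ 0) {v w : Fin 2 → ℤ}
    (hv : (A : Matrix (Fin 2) (Fin 2) ℤ) *ᵥ v = μ • v)
    (hw : (A : Matrix (Fin 2) (Fin 2) ℤ) *ᵥ w = μ • w + k • v) : T v = 0 := by
  have hμμ : μ * μ = 1 := by rw [← abs_mul_abs_self, hμ, one_mul]
  have key : ∀ n : ℕ, T (w + (n * μ * k) • v) = T w := by
    intro n
    induction n with
    | zero => simp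
    | succ n ih =>
      have : (A : Matrix (Fin 2) (Fin 2) ℤ) *ᵥ (w + (n * μ * k) • v)
          = μ • (w + ((n + 1 : ℕ) * μ * k) • v) := by
        rw [Matrix.mulVec_add, Matrix.mulVec_smul, hv, hw]
        ext i
        simp
        linear_combination (-k * v i) * hμμ
      rw [← ih, ← hA (w + (n * μ * k) • v), this, hsmul, hμ]
      simp
  have hneg : T (-w) = T w := by simpa using hsmul (-1) w
  have hbound : ∀ n : ℕ, n * (|k| * T v) ≤ 2 * T w := by
    intro n
    have h := hadd (w + (n * μ * k) • v) (-w)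
    rw [add_neg_cancel_comm, key, hneg, hsmul, abs_mul, abs_mul, hμ] at h
    push_cast at h
    simp only [Nat.abs_cast] at h
    push_cast
    linarith
  have hk' : (0 : ℝ) < (|k| : ℤ) := by exact_mod_cast abs_pos.2 hk
  by_contra hne
  have hpos : 0 < (|k| : ℤ) * T v := mul_pos hk' ((hnn v).lt_of_ne' hne)
  obtain ⟨n, hn⟩ := exists_nat_gt (2 * T w / ((|k| : ℤ) * T v))
  rw [div_lt_iff₀ hpos] at hn
  linarith [hbound n]

/-- A seminorm on `ℤ²` invariant under `A` vanishes everywhere if `A` is hyperbolic, by the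
Cayley–Hamilton identity `tr A = A + adj A`, and at the eigenvectors `v` if `A` is parabolic,
because the orbit of some `w` runs along a line of direction `v`. -/
theorem invariant_seminorm_eq_zero
    (hnn : ∀ v, 0 ≤ T v) (hadd : ∀ v w, T (v + w) ≤ T v + T w)
    (hsmul : ∀ (k : ℤ) v, T (k • v) = |k| * T v)
    (hA : ∀ v, T ((A : Matrix (Fin 2) (Fin 2) ℤ) *ᵥ v) = T v) {v : Fin 2 → ℤ}
    (hv : 2 < |(A : Matrix (Fin 2) (Fin 2) ℤ).trace| ∨
      (|(A : Matrix (Fin 2) (Fin 2) ℤ).trace| = 2 ∧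
        (A : Matrix (Fin 2) (Fin 2) ℤ) ≠ 1 ∧ (A : Matrix (Fin 2) (Fin 2) ℤ) ≠ -1 ∧
        ∃ μ : ℤ, Module.End.HasEigenvector
          (Matrix.toLin' (A : Matrix (Fin 2) (Fin 2) ℤ)) μ v)) : T v = 0 := by
  rcases hv with htr | ⟨htr, h1, h2, μ, hμ⟩
  · exact invariant_seminorm_eq_zero_of_two_lt_abs_trace hnn hadd hsmul hA htr v
  · have hAv : (A : Matrix (Fin 2) (Fin 2) ℤ) *ᵥ v = μ • v := hμ.apply_eq_smul
    obtain ⟨hμ1, w, k, hk, hw⟩ :=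
      exists_mulVec_eq_smul_add_smul (det_eq_one_or_neg_one A) htr h1 h2 hμ.2 hAv
    exact invariant_seminorm_eq_zero_of_parabolic hnn hadd hsmul hA hμ1 hk hAv hw

end InvariantSeminorm

/-! ### Distortion of lattice elements in `ℤ² ⋊_A ℤ` -/

section LatticeElt

variable {A : GL (Fin 2) ℤ}

theorem latticeElt_add (v w : Fin 2 → ℤ) :
    latticeElt A (v + w) = latticeElt A v * latticeElt A w := by
  simp [latticeElt]

theorem latticeElt_nsmul (n : ℕ) (v : Fin 2 → ℤ) :
    latticeElt A (n • v) = latticeElt A v ^ n := by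
  rw [latticeElt, ofAdd_nsmul, map_pow, latticeElt]

theorem latticeElt_neg (v : Fin 2 → ℤ) : latticeElt A (-v) = (latticeElt A v)⁻¹ := by
  simp [latticeElt]

theorem commute_latticeElt (v w : Fin 2 → ℤ) : Commute (latticeElt A v) (latticeElt A w) := by
  rw [Commute, SemiconjBy, ← latticeElt_add, ← latticeElt_add, add_comm]

theorem latticeElt_mulVec (v : Fin 2 → ℤ) :
    latticeElt A ((A : Matrix (Fin 2) (Fin 2) ℤ) *ᵥ v) =
      SemidirectProduct.inr (Multiplicative.ofAdd 1) * latticeElt A v *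
        (SemidirectProduct.inr (Multiplicative.ofAdd 1))⁻¹ := by
  rw [latticeElt, latticeElt, ← map_inv, ← SemidirectProduct.inl_aut, zpowersHom_apply]
  simp only [toAdd_ofAdd, zpow_one]
  rfl

/-- The symmetrised stable length `v ↦ τ(v) + τ(-v)` is a seminorm on `ℤ²`, invariant under `A`
since `v` and `A v` are conjugate in `ℤ² ⋊_A ℤ`. -/
theorem stableLength_latticeElt_eq_zero {v : Fin 2 → ℤ}
    (hv : 2 < |(A : Matrix (Fin 2) (Fin 2) ℤ).trace| ∨
      (|(A : Matrix (Fin 2) (Fin 2) ℤ).trace| = 2 ∧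
        (A : Matrix (Fin 2) (Fin 2) ℤ) ≠ 1 ∧ (A : Matrix (Fin 2) (Fin 2) ℤ) ≠ -1 ∧
        ∃ μ : ℤ, Module.End.HasEigenvector
          (Matrix.toLin' (A : Matrix (Fin 2) (Fin 2) ℤ)) μ v))
    {ℓ : SemidirectGroup A → ℝ} (hnn : ∀ g, 0 ≤ ℓ g) (hmul : ∀ g h, ℓ (g * h) ≤ ℓ g + ℓ h) :
    stableLength ℓ (latticeElt A v) = 0 := by
  set τ : (Fin 2 → ℤ) → ℝ := fun v => stableLength ℓ (latticeElt A v) with hτ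
  have hτnn : ∀ v, 0 ≤ τ v := fun v => stableLength_nonneg hnn _
  have hτadd : ∀ v w, τ (v + w) ≤ τ v + τ w := fun v w => by
    simp only [hτ, latticeElt_add]
    exact stableLength_mul_le hnn hmul (commute_latticeElt v w)
  have hτA : ∀ v, τ ((A : Matrix (Fin 2) (Fin 2) ℤ) *ᵥ v) = τ v := fun v => by
    simp only [hτ, latticeElt_mulVec]
    exact stableLength_conj hnn hmul _ _
  have hτsmul : ∀ (n : ℕ) v, τ ((n : ℤ) • v) = n * τ v := fun n v => by
    simp only [hτ, natCast_zsmul, latticeElt_nsmul]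
    exact stableLength_pow hnn hmul _ _
  have hT : τ v + τ (-v) = 0 := by
    refine invariant_seminorm_eq_zero (A := A) (T := fun v => τ v + τ (-v)) (v := v)
      (fun v => add_nonneg (hτnn v) (hτnn _)) (fun v w => ?_) (fun k v => ?_) (fun v => ?_) hv
    · rw [neg_add]
      linarith [hτadd v w, hτadd (-v) (-w)]
    · rcases Int.eq_nat_or_neg k with ⟨n, rfl | rfl⟩
      · simp only [← smul_neg, hτsmul]
        simp
        ring
      · simp only [← smul_neg, neg_smul, neg_neg, hτsmul]
        simp
        ring
    · rw [← Matrix.mulVec_neg, hτA, hτA]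
  linarith [hτnn v, hτnn (-v)]

/-- Let `P g a` say that `g` has size at most `exp a`, in a sense that is submultiplicative in `g`.
Then the powers of a distorted lattice element have subexponential size. -/
theorem exists_rate_bound_latticeElt_pow {v : Fin 2 → ℤ}
    (hv : 2 < |(A : Matrix (Fin 2) (Fin 2) ℤ).trace| ∨
      (|(A : Matrix (Fin 2) (Fin 2) ℤ).trace| = 2 ∧
        (A : Matrix (Fin 2) (Fin 2) ℤ) ≠ 1 ∧ (A : Matrix (Fin 2) (Fin 2) ℤ) ≠ -1 ∧
        ∃ μ : ℤ, Module.End.HasEigenvector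
          (Matrix.toLin' (A : Matrix (Fin 2) (Fin 2) ℤ)) μ v))
    {P : SemidirectGroup A → ℝ → Prop} (hP : ∀ g, ∃ a, 0 ≤ a ∧ P g a)
    (hmul : ∀ g h a b, P g a → P h b → P (g * h) (a + b)) {η : ℝ} (hη : 0 < η) :
    ∃ C, 0 ≤ C ∧ ∀ n : ℕ, ∃ a, 0 ≤ a ∧ a ≤ η * n + C ∧ P (latticeElt A v ^ n) a := by
  set S : SemidirectGroup A → Set ℝ := fun g => {a | 0 ≤ a ∧ P g a} with hS
  have hbdd : ∀ g, BddBelow (S g) := fun g => ⟨0, fun a ha => ha.1⟩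
  have hne : ∀ g, (S g).Nonempty := hP
  have hnn : ∀ g, 0 ≤ sInf (S g) := fun g => Real.sInf_nonneg fun a ha => ha.1
  have hsub : ∀ g h, sInf (S (g * h)) ≤ sInf (S g) + sInf (S h) := fun g h => by
    rw [← csInf_add (hne g) (hbdd g) (hne h) (hbdd h)]
    refine csInf_le_csInf (hbdd _) ((hne g).add (hne h)) ?_
    rintro _ ⟨a, ha, b, hb, rfl⟩
    exact ⟨add_nonneg ha.1 hb.1, hmul g h a b ha.2 hb.2⟩
  have hlim := tendsto_stableLength hnn hsub (latticeElt A v)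
  rw [stableLength_latticeElt_eq_zero hv hnn hsub] at hlim
  obtain ⟨N, hN⟩ := eventually_atTop.1
    ((hlim.eventually (gt_mem_nhds hη)).and (eventually_gt_atTop 0))
  choose f hf0 hfP using fun n : ℕ => hP (latticeElt A v ^ n)
  refine ⟨∑ i ∈ Finset.range N, f i, Finset.sum_nonneg fun i _ => hf0 i, fun n => ?_⟩
  rcases lt_or_ge n N with hn | hn
  · refine ⟨f n, hf0 n, ?_, hfP n⟩
    have := Finset.single_le_sum (fun i _ => hf0 i) (Finset.mem_range.2 hn)
    have : 0 ≤ η * n := by positivity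
    linarith
  · obtain ⟨h1, h2⟩ := hN n hn
    rw [div_lt_iff₀ (by exact_mod_cast h2)] at h1
    obtain ⟨a, ha, haη⟩ := exists_lt_of_csInf_lt (hne _) h1
    exact ⟨a, ha.1, by linarith [Finset.sum_nonneg fun i (_ : i ∈ Finset.range N) => hf0 i], ha.2⟩

end LatticeElt

/-! ### Covering numbers -/

section Covering

/-- The set `s` is covered, for every `δ ∈ (0, 1]`, by at most `C * δ⁻¹ ^ m` balls of radius `δ`;
that is, its upper box dimension is at most `m` in a quantitative form. -/
def HasBoxCovers {X : Type*} [MetricSpace X] (s : Set X) (m : ℕ) : Prop :=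
  ∃ C : ℝ, ∀ δ : ℝ, 0 < δ → δ ≤ 1 →
    ∃ t : Finset X, (t.card : ℝ) ≤ C * δ⁻¹ ^ m ∧ ∀ x ∈ s, ∃ y ∈ t, dist x y < δ

/-- A set on which some bounded map to `ℝᵐ` does not contract distances much has the covering
numbers of a bounded set of `ℝᵐ`: pick one point in the preimage of each cell of a grid. -/
theorem hasBoxCovers_of_map_pi {X : Type*} [MetricSpace X] {s : Set X} {m : ℕ}
    (f : X → Fin m → ℝ) {K R : ℝ} (hK : 0 < K)
    (hf : ∀ y ∈ s, ∀ z ∈ s, dist y z ≤ K * dist (f y) (f z))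
    (hR : ∀ y ∈ s, ‖f y‖ ≤ R) : HasBoxCovers s m := by
  classical
  rcases s.eq_empty_or_nonempty with rfl | ⟨x₀, hx₀⟩
  · exact ⟨0, fun δ _ _ => ⟨∅, by simp⟩⟩
  have hR0 : 0 ≤ R := (norm_nonneg _).trans (hR x₀ hx₀)
  refine ⟨(4 * K * R + 5) ^ m, fun δ hδ hδ1 => ?_⟩
  -- Cells of side `ε` have `s`-preimages of diameter at most `K * ε < δ`.
  set ε : ℝ := δ / (2 * K) with hε
  have hε0 : 0 < ε := by positivity
  set N : ℤ := ⌈R / ε⌉ + 1 with hN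
  have hNnn : 0 ≤ N := by
    have : 0 ≤ ⌈R / ε⌉ := Int.ceil_nonneg (by positivity)
    omega
  set cell : X → Fin m → ℤ := fun x i => ⌊f x i / ε⌋ with hcell
  set rep : (Fin m → ℤ) → X := fun c => if h : ∃ x ∈ s, cell x = c then h.choose else x₀ with hrep
  have hrep_spec : ∀ x ∈ s, rep (cell x) ∈ s ∧ cell (rep (cell x)) = cell x := by
    intro x hx
    have h : ∃ x' ∈ s, cell x' = cell x := ⟨x, hx, rfl⟩
    simp only [hrep, dif_pos h]
    exact h.choose_spec
  refine ⟨(Fintype.piFinset fun _ : Fin m => Finset.Icc (-N) N).image rep, ?_, fun x hx => ?_⟩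
  · refine (Nat.cast_le.2 Finset.card_image_le).trans ?_
    rw [Fintype.card_piFinset_const, Int.card_Icc, Nat.cast_pow, ← mul_pow]
    gcongr
    have h1 : (((N + 1 - -N).toNat : ℕ) : ℝ) = 2 * N + 1 := by
      rw [← Int.cast_natCast, Int.toNat_of_nonneg (by omega)]
      push_cast
      ring
    have h2 : (N : ℝ) ≤ R / ε + 2 := by
      rw [hN]
      push_cast
      linarith [(Int.ceil_lt_add_one (R / ε)).le]
    have h3 : R / ε = 2 * K * R * δ⁻¹ := by
      rw [hε]
      field_simp
    have h4 : 1 ≤ δ⁻¹ := (one_le_inv₀ hδ).2 hδ1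
    rw [h1]
    nlinarith
  · obtain ⟨hs, hc⟩ := hrep_spec x hx
    refine ⟨rep (cell x), Finset.mem_image_of_mem _ ?_, ?_⟩
    · rw [Fintype.mem_piFinset]
      intro i
      have h1 : |f x i| ≤ R := (norm_le_pi_norm (f x) i).trans (hR x hx)
      obtain ⟨h2, h3⟩ := abs_le.1 h1
      have h4 : f x i / ε ≤ R / ε := by gcongr
      have h5 : -(R / ε) ≤ f x i / ε := by rw [← neg_div]; gcongr
      have h6 := Int.le_ceil (R / ε)
      rw [Finset.mem_Icc]
      constructor
      · rw [hcell, Int.le_floor, hN]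
        push_cast
        linarith
      · have h7 : (cell x i : ℝ) ≤ N := by
          rw [hN]
          push_cast
          linarith [Int.floor_le (f x i / ε)]
        exact_mod_cast h7
    · have hd : dist (f x) (f (rep (cell x))) ≤ ε := by
        rw [dist_pi_le_iff hε0.le]
        intro i
        have h := Int.abs_sub_lt_one_of_floor_eq_floor (congrFun hc i).symm
        rw [← sub_div, abs_div, abs_of_pos hε0, div_lt_one hε0] at h
        exact h.le
      calc dist x (rep (cell x)) ≤ K * ε := (hf x hx _ hs).trans (by gcongr)
        _ = δ / 2 := by rw [hε]; field_simp
        _ < δ := half_lt_self hδ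

theorem hasBoxCovers_biUnion {X ι : Type*} [MetricSpace X] {m : ℕ} {s : ι → Set X}
    (hs : ∀ i, HasBoxCovers (s i) m) (J : Finset ι) : HasBoxCovers (⋃ i ∈ J, s i) m := by
  classical
  choose C hC using hs
  refine ⟨∑ i ∈ J, C i, fun δ hδ hδ1 => ?_⟩
  choose t ht hcov using fun i => hC i δ hδ hδ1
  refine ⟨J.biUnion t, ?_, fun x hx => ?_⟩
  · rw [Finset.sum_mul]
    refine (Nat.cast_le.2 Finset.card_biUnion_le).trans ?_
    push_cast
    exact Finset.sum_le_sum fun i _ => ht i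
  · obtain ⟨i, hi, hxi⟩ := Set.mem_iUnion₂.1 hx
    obtain ⟨y, hy, hxy⟩ := hcov i x hxi
    exact ⟨y, Finset.mem_biUnion.2 ⟨i, hi, hy⟩, hxy⟩

theorem hasBoxCovers_of_biLipschitz {X E : Type*} [MetricSpace X] [CompactSpace X]
    [NormedAddCommGroup E] [NormedSpace ℝ E] [FiniteDimensional ℝ E] {s : Set X} (φ : X → E)
    {K : ℝ} (hφ : ∀ y ∈ s, ∀ z ∈ s, dist (φ y) (φ z) ≤ K * dist y z ∧
      dist y z ≤ K * dist (φ y) (φ z)) : HasBoxCovers s (Module.finrank ℝ E) := by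
  let e : E ≃L[ℝ] (Fin (Module.finrank ℝ E) → ℝ) := (Module.finBasis ℝ E).equivFunL
  have hbdd : Bornology.IsBounded (φ '' s) := by
    refine Metric.isBounded_iff.2 ⟨|K| * Metric.diam (Set.univ : Set X), ?_⟩
    rintro _ ⟨y, hy, rfl⟩ _ ⟨z, hz, rfl⟩
    have hdiam : dist y z ≤ Metric.diam (Set.univ : Set X) :=
      Metric.dist_le_diam_of_mem isCompact_univ.isBounded (Set.mem_univ _) (Set.mem_univ _)
    calc dist (φ y) (φ z) ≤ K * dist y z := (hφ y hy z hz).1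
      _ ≤ |K| * Metric.diam (Set.univ : Set X) := by
        gcongr
        exact le_abs_self K
  obtain ⟨R, hR⟩ := (e.lipschitz.isBounded_image hbdd).exists_norm_le
  obtain ⟨L, hL⟩ : ∃ L, AntilipschitzWith L e := ⟨_, e.antilipschitz⟩
  refine hasBoxCovers_of_map_pi (fun x => e (φ x)) (K := (|K| + 1) * (L + 1)) (R := R)
    (by positivity) (fun y hy z hz => ?_)
    (fun y hy => hR _ (Set.mem_image_of_mem _ (Set.mem_image_of_mem _ hy)))
  calc dist y z ≤ K * dist (φ y) (φ z) := (hφ y hy z hz).2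
    _ ≤ (|K| + 1) * ((L + 1) * dist (e (φ y)) (e (φ z))) := by
      have h1 := hL.le_mul_dist (φ y) (φ z)
      gcongr
      · linarith [le_abs_self K]
      · nlinarith [dist_nonneg (x := e (φ y)) (y := e (φ z))]
    _ = _ := by ring

theorem HasBiLipschitzCharts.hasBoxCovers {E : Type*} [NormedAddCommGroup E] [NormedSpace ℝ E]
    [FiniteDimensional ℝ E] {H : Type*} [TopologicalSpace H] {I : ModelWithCorners ℝ E H}
    {M : Type*} [MetricSpace M] [CompactSpace M] [ChartedSpace H M]
    (h : HasBiLipschitzCharts I M) : HasBoxCovers (Set.univ : Set M) (Module.finrank ℝ E) := by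
  choose U hU _ hK using h
  obtain ⟨J, hJ⟩ := CompactSpace.elim_nhds_subcover U hU
  have hbox : ∀ x, HasBoxCovers (U x) (Module.finrank ℝ E) := fun x =>
    hasBoxCovers_of_biLipschitz (extChartAt I x) (hK x).choose_spec
  have := hasBoxCovers_biUnion hbox J
  rwa [hJ] at this

end Covering

/-! ### Entropy and Lipschitz growth -/

section Entropy

/-- A map of a space of finite box dimension whose iterates have subexponentially growing Lipschitz
constants has zero entropy: balls of radius `ε` divided by the Lipschitz bound up to time `n` are
contained in the dynamical balls of order `n`. -/
theorem topEntropy_eq_zero {X : Type*} [MetricSpace X] [Nonempty X] {m : ℕ}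
    (hX : HasBoxCovers (Set.univ : Set X) m) {T : X → X}
    (hT : ∀ η : ℝ, 0 < η → ∃ C : ℝ, 0 ≤ C ∧ ∀ n : ℕ, ∀ x y,
      dist (T^[n] x) (T^[n] y) ≤ Real.exp (η * n + C) * dist x y) :
    topEntropy T = 0 := by
  refine le_antisymm ?_ (Dynamics.coverEntropy_nonneg T Set.univ_nonempty)
  rw [topEntropy, Dynamics.coverEntropy_eq_iSup_basis Metric.uniformity_basis_dist]
  refine iSup₂_le fun ε hε => EReal.le_of_forall_lt_iff_le.1 fun z hz => ?_
  replace hz : 0 < z := by exact_mod_cast hz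
  obtain ⟨B, hB⟩ := hX
  set η : ℝ := z / (m + 1) with hη
  obtain ⟨C, hC0, hC⟩ := hT η (by positivity)
  set r : ℝ := min 1 ε
  have hr0 : 0 < r := lt_min one_pos hε
  have hB0 : 0 ≤ B := by
    obtain ⟨t, ht, -⟩ := hB 1 one_pos le_rfl
    simpa using (Nat.cast_nonneg _).trans ht
  -- Any constant `D` with `B * (r⁻¹ * exp C) ^ m ≤ exp D` will do.
  obtain ⟨D, hD⟩ : ∃ D, B * (r⁻¹ * Real.exp C) ^ m ≤ Real.exp D :=
    ⟨_, (lt_add_one _).le.trans (Real.exp_log (add_pos_of_nonneg_of_pos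
      (by positivity) one_pos)).ge⟩
  have hcard : ∀ n : ℕ, ((Dynamics.coverMincard T Set.univ {p : X × X | dist p.1 p.2 < ε} n : ℕ∞) :
      ENNReal) ≤ ENNReal.ofReal (Real.exp (m * η * n + D)) := by
    intro n
    obtain ⟨t, ht, hcov⟩ := hB (r * Real.exp (-(η * n + C))) (by positivity)
      (mul_le_one₀ (min_le_left _ _) (Real.exp_pos _).le
        (Real.exp_le_one_iff.2 (by have : 0 ≤ η * n := by positivity
                                   linarith)))
    have hdyn : Dynamics.IsDynCoverOf T Set.univ {p : X × X | dist p.1 p.2 < ε} n (t : Set X) := by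
      intro x _
      obtain ⟨y, hy, hxy⟩ := hcov x (Set.mem_univ x)
      refine ⟨y, hy, Dynamics.mem_dynEntourage.2 fun k hk => ?_⟩
      calc dist (T^[k] x) (T^[k] y) ≤ Real.exp (η * k + C) * dist x y := hC k x y
        _ ≤ Real.exp (η * n + C) * dist x y := by gcongr
        _ < Real.exp (η * n + C) * (r * Real.exp (-(η * n + C))) := by gcongr
        _ = r := by rw [Real.exp_neg]; field_simp
        _ ≤ ε := min_le_right _ _
    have h1 : ((Dynamics.coverMincard T Set.univ {p : X × X | dist p.1 p.2 < ε} n : ℕ∞) : ENNReal) ≤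
        ((t.card : ℕ∞) : ENNReal) := by exact_mod_cast hdyn.coverMincard_le_card
    refine h1.trans ?_
    rw [ENat.toENNReal_coe, ← ENNReal.ofReal_natCast]
    refine ENNReal.ofReal_le_ofReal (ht.trans ?_)
    calc B * (r * Real.exp (-(η * n + C)))⁻¹ ^ m
        = Real.exp (m * η * n) * (B * (r⁻¹ * Real.exp C) ^ m) := by
          rw [mul_assoc (m : ℝ), Real.exp_nat_mul, Real.exp_neg, Real.exp_add, mul_inv, inv_inv]
          ring
      _ ≤ Real.exp (m * η * n) * Real.exp D := by gcongr
      _ = _ := (Real.exp_add _ _).symm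
  have hlim : ∀ᶠ n : ℕ in atTop, m * η * n + D ≤ z * n := by
    have hz' : z = m * η + η := by rw [hη]; field_simp
    obtain ⟨n₀, hn₀⟩ := exists_nat_ge (D / η)
    filter_upwards [eventually_ge_atTop n₀] with n hn
    have : D / η ≤ n := hn₀.trans (by exact_mod_cast hn)
    rw [div_le_iff₀ (by positivity)] at this
    rw [hz']
    linarith
  refine Filter.limsup_le_of_le (by isBoundedDefault) ?_
  filter_upwards [hlim, eventually_gt_atTop 0] with n hn hn0
  have hlog : ENNReal.log (Dynamics.coverMincard T Set.univ {p : X × X | dist p.1 p.2 < ε} n : ℕ∞) ≤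
      ((z * n : ℝ) : EReal) := by
    refine (ENNReal.log_monotone (hcard n)).trans ?_
    rw [ENNReal.log_ofReal_of_pos (Real.exp_pos _), Real.log_exp]
    exact_mod_cast hn
  rw [EReal.div_le_iff_le_mul (by exact_mod_cast hn0) (EReal.natCast_ne_top n), mul_comm]
  exact_mod_cast hlog

end Entropy

/-! ### Derivative growth and Lyapunov exponents -/

section Derivative

variable {E : Type*} [NormedAddCommGroup E] [NormedSpace ℝ E]
  {H : Type*} [TopologicalSpace H] {I : ModelWithCorners ℝ E H}
  {M : Type*} [TopologicalSpace M] [ChartedSpace H M] [IsManifold I 2 M]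
  [RiemannianBundle (fun x : M => TangentSpace I x)]
  [IsContinuousRiemannianBundle E (fun x : M => TangentSpace I x)]

/-- In the trivializations of the tangent bundle at `x` and `f x` the derivative is continuous, and
these trivializations are locally bounded for a continuous Riemannian metric. -/
theorem eventually_norm_mfderiv_le {f : M → M} (hf : ContMDiff I I 2 f) (x : M) :
    ∃ C : ℝ, 0 ≤ C ∧ ∀ᶠ y in 𝓝 x, ∀ u : TangentSpace I y, ‖mfderiv I I f y u‖ ≤ C * ‖u‖ := by
  obtain ⟨C₁, hC₁, h₁⟩ :=
    eventually_norm_trivializationAt_lt E (fun x : M => TangentSpace I x) x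
  obtain ⟨C₂, hC₂, h₂⟩ :=
    eventually_norm_symmL_trivializationAt_lt E (fun x : M => TangentSpace I x) (f x)
  have hcont : ContinuousAt (inTangentCoordinates I I id f (mfderiv I I f) x) x :=
    ((hf x).mfderiv_const (m := 1) (by norm_num)).continuousAt
  have h₃ := hcont.norm.eventually (gt_mem_nhds (lt_add_one _))
  set C₃ := ‖inTangentCoordinates I I id f (mfderiv I I f) x x‖ + 1
  have hC₃0 : 0 ≤ C₃ := by positivity
  have hb₁ := (trivializationAt E (fun x : M => TangentSpace I x) x).open_baseSet.mem_nhds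
    (FiberBundle.mem_baseSet_trivializationAt' x)
  have hb₂ := hf.continuous.continuousAt.preimage_mem_nhds
    ((trivializationAt E (fun x : M => TangentSpace I x) (f x)).open_baseSet.mem_nhds
      (FiberBundle.mem_baseSet_trivializationAt' (f x)))
  refine ⟨C₂ * (C₃ * C₁), by positivity, ?_⟩
  filter_upwards [h₁, hf.continuous.continuousAt.eventually h₂, h₃, hb₁, hb₂]
    with y hy₁ hy₂ hy₃ hyb₁ hyb₂ u
  set e := trivializationAt E (fun x : M => TangentSpace I x) x
  set e' := trivializationAt E (fun x : M => TangentSpace I x) (f x)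
  have key : mfderiv I I f y u = e'.symmL ℝ (f y)
      (inTangentCoordinates I I id f (mfderiv I I f) x y (e.continuousLinearMapAt ℝ y u)) := by
    have h : inTangentCoordinates I I id f (mfderiv I I f) x y (e.continuousLinearMapAt ℝ y u)
        = e'.continuousLinearMapAt ℝ (f y)
          (mfderiv I I f y (e.symmL ℝ y (e.continuousLinearMapAt ℝ y u))) := rfl
    rw [h, e.symmL_continuousLinearMapAt hyb₁, e'.symmL_continuousLinearMapAt hyb₂]
  rw [key]
  calc _ ≤ C₂ * ‖inTangentCoordinates I I id f (mfderiv I I f) x y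
          (e.continuousLinearMapAt ℝ y u)‖ := ContinuousLinearMap.le_of_opNorm_le _ hy₂.le _
    _ ≤ C₂ * (C₃ * ‖e.continuousLinearMapAt ℝ y u‖) := by
        gcongr
        exact ContinuousLinearMap.le_of_opNorm_le _ hy₃.le _
    _ ≤ C₂ * (C₃ * (C₁ * ‖u‖)) := by
        gcongr
        exact ContinuousLinearMap.le_of_opNorm_le _ hy₁.le _
    _ = _ := by ring

omit [IsManifold I 2 M] [IsContinuousRiemannianBundle E (fun x : M => TangentSpace I x)] in
/-- The composite is given up to an equality of maps, so that the two norms may live on tangent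
spaces at points that are equal, but not definitionally so. -/
theorem norm_mfderiv_of_eq_comp {f h F : M → M} (hF : F = h ∘ f) {x : M}
    (hf : MDifferentiableAt I I f x) (hh : MDifferentiableAt I I h (f x)) (u : TangentSpace I x) :
    ‖mfderiv I I F x u‖ = ‖mfderiv I I h (f x) (mfderiv I I f x u)‖ := by
  subst hF
  exact congrArg (fun w : TangentSpace I (h (f x)) => ‖w‖) (mfderiv_comp_apply x hh hf u)

theorem exists_norm_mfderiv_le_exp [CompactSpace M] {f : M → M} (hf : ContMDiff I I 2 f) :
    ∃ a : ℝ, 0 ≤ a ∧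
      ∀ (x : M) (u : TangentSpace I x), ‖mfderiv I I f x u‖ ≤ Real.exp a * ‖u‖ := by
  choose C hC0 hC using eventually_norm_mfderiv_le hf
  obtain ⟨J, hJ⟩ := CompactSpace.elim_nhds_subcover
    (fun x => {y | ∀ u : TangentSpace I y, ‖mfderiv I I f y u‖ ≤ C x * ‖u‖}) hC
  refine ⟨∑ x ∈ J, C x, Finset.sum_nonneg fun x _ => hC0 x, fun y u => ?_⟩
  have hy : y ∈ ⋃ x ∈ J, {y | ∀ u : TangentSpace I y, ‖mfderiv I I f y u‖ ≤ C x * ‖u‖} := by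
    rw [hJ]; exact Set.mem_univ y
  obtain ⟨x, hx, hxy⟩ := Set.mem_iUnion₂.1 hy
  refine (hxy u).trans ?_
  gcongr
  have h1 := Finset.single_le_sum (fun x _ => hC0 x) hx
  linarith [Real.add_one_le_exp (∑ x ∈ J, C x)]

omit [IsManifold I 2 M] [IsContinuousRiemannianBundle E (fun x : M => TangentSpace I x)] in
/-- Since `g⁻ⁿ` inverts `gⁿ`, subexponential upper bounds for the derivatives of the positive and of
the negative powers of `g` also bound `‖D gⁿ u‖` from below, and all Lyapunov exponents vanish. -/
theorem hasLyapunovExponent_zero {G : Type*} [Group G] [MulAction G M]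
    (hG : ∀ g : G, ContMDiff I I 2 (fun x : M => g • x)) {g : G}
    (hg : ∀ η : ℝ, 0 < η → ∃ C : ℝ, ∀ n : ℕ, ∀ (x : M) (u : TangentSpace I x),
      ‖mfderiv I I (fun y : M => g ^ n • y) x u‖ ≤ Real.exp (η * n + C) * ‖u‖ ∧
      ‖mfderiv I I (fun y : M => g⁻¹ ^ n • y) x u‖ ≤ Real.exp (η * n + C) * ‖u‖)
    (x : M) {u : TangentSpace I x} (hu : u ≠ 0) :
    HasLyapunovExponent I (fun y : M => g • y) x u 0 := by
  have hu0 : 0 < ‖u‖ := norm_pos_iff.2 hu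
  rw [HasLyapunovExponent, Metric.tendsto_atTop]
  intro η hη
  obtain ⟨C, hC⟩ := hg (η / 2) (by positivity)
  obtain ⟨n₀, hn₀⟩ := exists_nat_gt (2 * (|C| + |Real.log ‖u‖|) / η)
  rw [div_lt_iff₀ hη] at hn₀
  refine ⟨n₀ + 1, fun n hn => ?_⟩
  have hn' : (n₀ : ℝ) ≤ n := by exact_mod_cast (by omega : n₀ ≤ n)
  have hnpos : (0 : ℝ) < n := by exact_mod_cast (by omega : 0 < n)
  rw [smul_iterate]
  set w := mfderiv I I (fun y : M => g ^ n • y) x u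
  have hinv : ‖mfderiv I I (fun y : M => g⁻¹ ^ n • y) (g ^ n • x) w‖ = ‖u‖ := by
    have hid : id = (fun y : M => g⁻¹ ^ n • y) ∘ (fun y : M => g ^ n • y) := by
      ext y
      simp [smul_smul]
    rw [← norm_mfderiv_of_eq_comp hid ((hG (g ^ n)).mdifferentiable two_ne_zero x)
      ((hG (g⁻¹ ^ n)).mdifferentiable two_ne_zero (g ^ n • x)), mfderiv_id]
    rfl
  have hup : ‖w‖ ≤ Real.exp (η / 2 * n + C) * ‖u‖ := (hC n x u).1
  have hlow : ‖u‖ ≤ Real.exp (η / 2 * n + C) * ‖w‖ := by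
    have h := (hC n (g ^ n • x) w).2
    rwa [hinv] at h
  have hw0 : 0 < ‖w‖ := by
    by_contra! h
    have := norm_nonneg w
    rw [le_antisymm h this, mul_zero] at hlow
    linarith
  have hup' := Real.log_le_log hw0 hup
  have hlow' := Real.log_le_log hu0 hlow
  rw [Real.log_mul (Real.exp_pos _).ne' hu0.ne', Real.log_exp] at hup'
  rw [Real.log_mul (Real.exp_pos _).ne' hw0.ne', Real.log_exp] at hlow'
  have h1 := le_abs_self C
  have h2 := neg_abs_le (Real.log ‖u‖)
  have h3 := le_abs_self (Real.log ‖u‖)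
  have h4 : (n₀ : ℝ) * η ≤ n * η := by gcongr
  rw [Real.dist_eq, sub_zero, abs_div, abs_of_pos hnpos, div_lt_iff₀ hnpos, abs_lt]
  constructor <;> linarith

end Derivative

/-! ### Actions of `ℤ² ⋊_A ℤ` -/

theorem corollary0p2 (A : GL (Fin 2) ℤ) (v : Fin 2 → ℤ)
    (hv : 2 < |(A : Matrix (Fin 2) (Fin 2) ℤ).trace| ∨
      (|(A : Matrix (Fin 2) (Fin 2) ℤ).trace| = 2 ∧
        (A : Matrix (Fin 2) (Fin 2) ℤ) ≠ 1 ∧ (A : Matrix (Fin 2) (Fin 2) ℤ) ≠ -1 ∧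
        ∃ μ : ℤ, Module.End.HasEigenvector
          (Matrix.toLin' (A : Matrix (Fin 2) (Fin 2) ℤ)) μ v))
    {E : Type*} [NormedAddCommGroup E] [NormedSpace ℝ E] [FiniteDimensional ℝ E]
    {H : Type*} [TopologicalSpace H] (I : ModelWithCorners ℝ E H) :
    (∀ (M : Type*) [MetricSpace M] [CompactSpace M] [Nonempty M] [ChartedSpace H M]
        [MulAction (SemidirectGroup A) M],
      HasBiLipschitzCharts I M →
      (∀ g : SemidirectGroup A, ∃ K, LipschitzWith K (fun x : M => g • x)) →
      topEntropy (fun x : M => latticeElt A v • x) = 0) ∧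
    (∀ (M : Type*) [TopologicalSpace M] [T2Space M] [CompactSpace M] [ChartedSpace H M]
        [IsManifold I 2 M] [RiemannianBundle (fun x : M => TangentSpace I x)]
        [IsContinuousRiemannianBundle E (fun x : M => TangentSpace I x)]
        [MulAction (SemidirectGroup A) M],
      (∀ g : SemidirectGroup A, ContMDiff I I 2 (fun x : M => g • x)) →
      ∀ (x : M) (u : TangentSpace I x), u ≠ 0 →
        HasLyapunovExponent I (fun y : M => latticeElt A v • y) x u 0) := by
  refine ⟨fun M _ _ _ _ _ hcharts hLip => ?_, fun M _ _ _ _ _ _ _ _ hdiff x u hu => ?_⟩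
  · have hP : ∀ g : SemidirectGroup A, ∃ a : ℝ, 0 ≤ a ∧ ∀ x y : M,
        dist (g • x) (g • y) ≤ Real.exp a * dist x y := by
      intro g
      obtain ⟨K, hK⟩ := hLip g
      refine ⟨K, K.2, fun x y => (hK.dist_le_mul x y).trans ?_⟩
      gcongr
      linarith [Real.add_one_le_exp (K : ℝ)]
    have hmul : ∀ (g h : SemidirectGroup A) (a b : ℝ),
        (∀ x y : M, dist (g • x) (g • y) ≤ Real.exp a * dist x y) →
        (∀ x y : M, dist (h • x) (h • y) ≤ Real.exp b * dist x y) →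
        ∀ x y : M, dist ((g * h) • x) ((g * h) • y) ≤ Real.exp (a + b) * dist x y := by
      intro g h a b hg hh x y
      rw [mul_smul, mul_smul, Real.exp_add, mul_assoc]
      refine (hg _ _).trans ?_
      gcongr
      exact hh x y
    refine topEntropy_eq_zero hcharts.hasBoxCovers fun η hη => ?_
    obtain ⟨C, hC0, hC⟩ := exists_rate_bound_latticeElt_pow hv hP hmul hη
    refine ⟨C, hC0, fun n x y => ?_⟩
    obtain ⟨a, -, ha, hPa⟩ := hC n
    rw [smul_iterate]
    refine (hPa x y).trans ?_
    gcongr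
  · -- The negative powers are the powers of the lattice element `-v`, which is again admissible.
    have hv' : 2 < |(A : Matrix (Fin 2) (Fin 2) ℤ).trace| ∨
        (|(A : Matrix (Fin 2) (Fin 2) ℤ).trace| = 2 ∧
          (A : Matrix (Fin 2) (Fin 2) ℤ) ≠ 1 ∧ (A : Matrix (Fin 2) (Fin 2) ℤ) ≠ -1 ∧
          ∃ μ : ℤ, Module.End.HasEigenvector
            (Matrix.toLin' (A : Matrix (Fin 2) (Fin 2) ℤ)) μ (-v)) :=
      hv.imp_right fun ⟨h, h1, h2, μ, hμ⟩ =>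
        ⟨h, h1, h2, μ, Submodule.neg_mem _ hμ.1, neg_ne_zero.2 hμ.2⟩
    have hP : ∀ g : SemidirectGroup A, ∃ a : ℝ, 0 ≤ a ∧ ∀ (x : M) (u : TangentSpace I x),
        ‖mfderiv I I (fun y : M => g • y) x u‖ ≤ Real.exp a * ‖u‖ := fun g =>
      exists_norm_mfderiv_le_exp (hdiff g)
    have hmul : ∀ (g h : SemidirectGroup A) (a b : ℝ),
        (∀ (x : M) (u : TangentSpace I x),
          ‖mfderiv I I (fun y : M => g • y) x u‖ ≤ Real.exp a * ‖u‖) →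
        (∀ (x : M) (u : TangentSpace I x),
          ‖mfderiv I I (fun y : M => h • y) x u‖ ≤ Real.exp b * ‖u‖) →
        ∀ (x : M) (u : TangentSpace I x),
          ‖mfderiv I I (fun y : M => (g * h) • y) x u‖ ≤ Real.exp (a + b) * ‖u‖ := by
      intro g h a b hg hh x u
      rw [norm_mfderiv_of_eq_comp (funext fun y => mul_smul g h y)
        ((hdiff h).mdifferentiable two_ne_zero x) ((hdiff g).mdifferentiable two_ne_zero (h • x)),
        Real.exp_add, mul_assoc]
      refine (hg _ _).trans ?_
      gcongr
      exact hh x u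
    refine hasLyapunovExponent_zero hdiff (fun η hη => ?_) x hu
    obtain ⟨C, -, hC⟩ := exists_rate_bound_latticeElt_pow hv hP hmul hη
    obtain ⟨C', -, hC'⟩ := exists_rate_bound_latticeElt_pow hv' hP hmul hη
    refine ⟨max C C', fun n x u => ⟨?_, ?_⟩⟩
    · obtain ⟨a, -, ha, hPa⟩ := hC n
      refine (hPa x u).trans ?_
      gcongr
      linarith [le_max_left C C']
    · obtain ⟨a, -, ha, hPa⟩ := hC' n
      rw [← latticeElt_neg]
      refine (hPa x u).trans ?_
      gcongr
      linarith [le_max_right C C']
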